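/- Let $R$ be a (not necessarily commutative) local ring with identity, with centre $Z(R)$ and Jacobson radical $J$. Let ${}_RM$ be a finitely generated semisimple left $R$-module and let $\varphi\in\mathrm{End}_R(M)$ be nilpotent of index $n$ (the least $n$ with $\varphi^n=0$). Let $X=\{x_{\gamma,i}\mid 1\le\gamma\le m,\ 1\le i\le k_\gamma\}$ be a nilpotent Jordan normal base of $M$ with respect to $\varphi$: all $k_\gamma\ge 1$, each $Rx_{\gamma,i}$ is a simple submodule, $M=\bigoplus_{\gamma,i}Rx_{\gamma,i}$, $\varphi(x_{\gamma,i})=x_{\gamma,i+1}$ for $i<k_\gamma$, and $\varphi(x_{\gamma,k_\gamma})=0$. Put $$\mathcal W(X)=\{[w_{\delta,\gamma}]\in \mathrm M_m(R/J)\mid w_{\delta,\gamma}=0 \text{ for all } \delta,\gamma \text{ with } k_\gamma\ge 2\},$$ which is a left ideal of the matrix ring $\mathrm M_m(R/J)$, hence a right ideal of the opposite ring $\mathrm M_m(R/J)^{\mathrm{op}}$. For a subset $T$ of a $Z(R)$-algebra $A$ and a noncommutative polynomial $f\in Z(R)\langle x_1,\dots,x_r\rangle$, say that $f=0$ is an identity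 of $T$ if $f(v_1,\dots,v_r)=0$ in $A$ for all $v_1,\dots,v_r\in T$. Let $f_1,\dots,f_n\in Z(R)\langle x_1,\dots,x_r\rangle$ be such that $f_i=0$ is an identity of the right ideal $\mathcal W(X)$ of the $Z(R)$-algebra $\mathrm M_m(R/J)^{\mathrm{op}}$ for each $1\le i\le n$. Then $f_1f_2\cdots f_n=0$ is an identity of the zero-level centralizer $$\mathrm{Cen}_0(\varphi)=\{\psi\in\mathrm{End}_R(M)\mid \psi\varphi=\varphi\psi=0\}$$ in the $Z(R)$-algebra $\mathrm{End}_R(M)$. -/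

import Mathlib

/-- The zero-level centralizer `{u ∈ S ∣ us = su = 0}` (two-sided annihilator) of an
element `s` of a ring `S`. -/
def zeroCentralizer {S : Type*} [Ring S] (s : S) : Set S :=
  {u | u * s = 0 ∧ s * u = 0}

/-- `f = 0` is a polynomial identity, with coefficients in the commutative ring `C`, of the
subset `T` of the `C`-algebra `A`: the noncommutative polynomial `f` vanishes (in `A`) under
every substitution of elements of `T` for its indeterminates. -/
def IsPolynomialIdentity {C A σ : Type*} [CommRing C] [Ring A] [Algebra C A]
    (T : Set A) (f : FreeAlgebra C σ) : Prop :=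
  ∀ v : σ → A, (∀ i, v i ∈ T) → FreeAlgebra.lift C v f = 0

/-- A nilpotent Jordan normal base of the left module `M` with respect to the endomorphism `φ`,
with set of blocks `Γ`. The elements of the block `γ` are numbered from `0` to `size γ - 1`. -/
structure NilpotentJordanBase {R M : Type*} [Ring R] [AddCommGroup M] [Module R M]
    (φ : Module.End R M) (Γ : Type*) where
  /-- the size of a block -/
  size : Γ → ℕ
  one_le_size : ∀ γ, 1 ≤ size γ
  size_bounded : ∃ N, ∀ γ, size γ ≤ N
  /-- the elements of the base -/
  vec : (γ : Γ) → Fin (size γ) → M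
  /-- every `R x` is simple -/
  isSimple : ∀ γ i, IsSimpleModule R (Submodule.span R {vec γ i})
  /-- the sum of the submodules `R x` is direct -/
  independent : iSupIndep fun p : (Σ γ, Fin (size γ)) => Submodule.span R {vec p.1 p.2}
  /-- the sum of the submodules `R x` is the whole module -/
  iSup_eq_top : (⨆ p : (Σ γ, Fin (size γ)), Submodule.span R {vec p.1 p.2}) = ⊤
  map_vec : ∀ (γ : Γ) (i j : Fin (size γ)), (j : ℕ) = i + 1 → φ (vec γ i) = vec γ j
  map_last : ∀ (γ : Γ) (i : Fin (size γ)), (i : ℕ) + 1 = size γ → φ (vec γ i) = 0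

/-- The left ideal of the matrix ring over `R/J` (with `J` the Jacobson radical of `R`) that
consists of the matrices `[w δ γ]` with `w δ γ = 0` whenever the block `γ` has size at least 2.
(For a noncommutative ring, `Ideal` means left ideal.) -/
def NilpotentJordanBase.leftIdealW {R M Γ : Type*} [Ring R] [AddCommGroup M] [Module R M]
    {φ : Module.End R M} [Fintype Γ] [DecidableEq Γ] (X : NilpotentJordanBase φ Γ) :
    Ideal (Matrix Γ Γ (R ⧸ Ring.jacobson R)) where
  carrier := {W | ∀ δ γ, 2 ≤ X.size γ → W δ γ = 0}
  zero_mem' := fun _ _ _ => rfl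
  add_mem' := fun {A B} hA hB δ γ h => by simp [hA δ γ h, hB δ γ h]
  smul_mem' := fun P W hW δ γ h => by
    rw [smul_eq_mul, Matrix.mul_apply]
    exact Finset.sum_eq_zero fun τ _ => by rw [hW τ γ h, mul_zero]

/-- The same subset, viewed in the opposite ring of the matrix ring, where it is a right ideal. -/
def NilpotentJordanBase.rightIdealW {R M Γ : Type*} [Ring R] [AddCommGroup M] [Module R M]
    {φ : Module.End R M} [Fintype Γ] [DecidableEq Γ] (X : NilpotentJordanBase φ Γ) :
    Set (Matrix Γ Γ (R ⧸ Ring.jacobson R))ᵐᵒᵖ :=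
  {W | W.unop ∈ X.leftIdealW}

/-! Over a local ring every simple `R x` is a copy of `R/J`, so the coordinates at the block heads
define `π : M → (R/J)^Γ`, whose kernel lies in `im φ`. If `ψφ = φψ = 0`, then `π` intertwines `ψ`
with right multiplication by a matrix: `ψφ = 0` makes it well defined, and `φψ = 0` puts it in
`W(X)`. Acting on row vectors reverses products, hence the opposite ring. Therefore `π ∘ fᵢ(ψ) = 0`,
so `fᵢ(ψ)` maps `M` into `im φ`. As each `fᵢ(ψ)` commutes with `φ`, the product of all `n` maps `M`
into `im φⁿ = 0`. -/

/-- All maximal left ideals of a (not necessarily commutative) local ring coincide. -/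
theorem IsLocalRing.le_of_isMaximal {R : Type*} [Ring R] [IsLocalRing R] {I I' : Ideal R}
    (hI : I ≠ ⊤) (hI' : I'.IsMaximal) : I ≤ I' := by
  by_contra hle
  have hsup : I' ⊔ I = ⊤ := hI'.1.2 _ (left_lt_sup.2 hle)
  have hone : (1 : R) ∈ I' ⊔ I := hsup ▸ Submodule.mem_top
  obtain ⟨y, hy, x, hx, hxy⟩ := Submodule.mem_sup.1 hone
  rcases IsLocalRing.isUnit_or_isUnit_of_add_one hxy with h | h
  · exact hI'.1.1 (Ideal.eq_top_of_isUnit_mem _ hy h)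
  · exact hI (Ideal.eq_top_of_isUnit_mem _ hx h)

/-- The Jacobson radical of a local ring is its unique maximal left ideal. -/
theorem IsLocalRing.eq_ringJacobson_of_isMaximal {R : Type*} [Ring R] [IsLocalRing R]
    {I : Ideal R} (hI : I.IsMaximal) : I = Ring.jacobson R := by
  refine le_antisymm ?_ (Ring.jacobson_le_of_isMaximal I)
  rw [Ring.jacobson_eq_sInf_isMaximal]
  exact le_sInf fun I' hI' => IsLocalRing.le_of_isMaximal hI.ne_top hI'

/-- Over a local ring, a simple cyclic module `R x` is isomorphic to `R ⧸ J` with `x ↦ 1`. -/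
theorem exists_linearEquiv_quotient_jacobson {R M : Type*} [Ring R] [IsLocalRing R]
    [AddCommGroup M] [Module R M] (x : M) (hx : IsSimpleModule R (Submodule.span R {x})) :
    ∃ e : Submodule.span R {x} ≃ₗ[R] R ⧸ Ring.jacobson R,
      e ⟨x, Submodule.mem_span_singleton_self x⟩ = 1 := by
  set y : Submodule.span R {x} := ⟨x, Submodule.mem_span_singleton_self x⟩ with hy
  have hy0 : y ≠ 0 := by
    intro h
    have hx0 : x = 0 := congrArg Subtype.val h
    have := IsSimpleModule.nontrivial R (Submodule.span R {x})
    rw [Submodule.nontrivial_iff_ne_bot] at this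
    exact this (by rw [hx0, Submodule.span_zero_singleton])
  have hker := IsLocalRing.eq_ringJacobson_of_isMaximal
    (IsSimpleModule.ker_toSpanSingleton_isMaximal R hy0)
  have hsurj := IsSimpleModule.toSpanSingleton_surjective R hy0
  let e := (Submodule.quotEquivOfEq _ _ hker.symm).trans
    ((LinearMap.toSpanSingleton R _ y).quotKerEquivOfSurjective hsurj)
  refine ⟨e.symm, ?_⟩
  rw [LinearEquiv.symm_apply_eq]
  change y = (1 : R) • y
  rw [one_smul]

/-- Coordinates with values in `R ⧸ J` of a module over a local ring which is the direct sum of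
simple cyclic submodules. -/
theorem exists_coordinates {R M ι : Type*} [Ring R] [IsLocalRing R]
    [AddCommGroup M] [Module R M] [DecidableEq ι] (x : ι → M)
    (hx : ∀ p, IsSimpleModule R (Submodule.span R {x p}))
    (ind : iSupIndep fun p => Submodule.span R {x p})
    (htop : ⨆ p, Submodule.span R {x p} = ⊤) :
    ∃ c : ι → M →ₗ[R] R ⧸ Ring.jacobson R,
      (∀ p q, c p (x q) = if q = p then 1 else 0) ∧
      ∀ (N : Submodule R M) (y : M), (∀ p, c p y = 0 ∨ x p ∈ N) → y ∈ N := by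
  choose e he using fun p => exists_linearEquiv_quotient_jacobson (x p) (hx p)
  let E := ind.linearEquiv htop
  refine ⟨fun p => (e p).toLinearMap ∘ₗ DFinsupp.lapply p ∘ₗ E.symm.toLinearMap, ?_, ?_⟩
  · intro p q
    have hq : E.symm (x q) =
        DFinsupp.single q ⟨x q, Submodule.mem_span_singleton_self (x q)⟩ := by
      rw [LinearEquiv.symm_apply_eq]
      simp only [E, iSupIndep.linearEquiv_apply]
      simp
    simp only [LinearMap.comp_apply, LinearEquiv.coe_coe, hq, DFinsupp.lapply_apply]
    split_ifs with h
    · subst h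
      rw [DFinsupp.single_eq_same, he]
    · rw [DFinsupp.single_eq_of_ne (Ne.symm h), map_zero]
  · classical
    intro N y hy
    -- `y` is the sum of its components, and each nonzero one lies in some `R x p ≤ N`.
    have hE : E (E.symm y) ∈ N := by
      simp only [E, iSupIndep.linearEquiv_apply]
      rw [DFinsupp.sumAddHom_apply]
      refine dfinsuppSum_mem N _ _ fun p hp => ?_
      rcases hy p with h | h
      · simp only [LinearMap.comp_apply, LinearEquiv.coe_coe, DFinsupp.lapply_apply,
          LinearEquiv.map_eq_zero_iff] at h
        exact absurd h hp
      · exact Submodule.span_singleton_le_iff_mem _ _ |>.2 h (E.symm y p).2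
    rwa [LinearEquiv.apply_symm_apply] at hE

/-- If a linear map `π : M → D ^ Γ`, with `D` a quotient ring of `R`, intertwines each endomorphism
`v i` with right multiplication by the matrix `w i`, then it does so for each value of a
noncommutative polynomial with central coefficients. -/
theorem FreeAlgebra.lift_intertwines_vecMul {R M Γ σ : Type*} [Ring R] [AddCommGroup M]
    [Module R M] [Fintype Γ] [DecidableEq Γ] (I : Ideal R) [I.IsTwoSided]
    (π : M →ₗ[R] (Γ → R ⧸ I)) (v : σ → Module.End R M) (w : σ → (Matrix Γ Γ (R ⧸ I))ᵐᵒᵖ)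
    (h : ∀ i y, π (v i y) = Matrix.vecMul (π y) (w i).unop)
    (f : FreeAlgebra (Subring.center R) σ) (y : M) :
    π (FreeAlgebra.lift (Subring.center R) v f y) =
      Matrix.vecMul (π y) (FreeAlgebra.lift (Subring.center R) w f).unop := by
  induction f using FreeAlgebra.induction generalizing y with
  | grade0 c =>
    -- Scalars act on the left, matrices on the right; the two agree because `c` is central.
    have hc : π (c • y) = Matrix.vecMul (π y)
        (algebraMap (Subring.center R) (Matrix Γ Γ (R ⧸ I)) c) := by
      ext γ
      rw [show c • y = (c : R) • y from rfl, map_smul, Matrix.algebraMap_eq_diagonal,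
        Matrix.vecMul_diagonal, Pi.smul_apply]
      obtain ⟨s, hs⟩ := Ideal.Quotient.mk_surjective (π y γ)
      rw [← hs]
      change Ideal.Quotient.mk I ((c : R) * s) = Ideal.Quotient.mk I (s * (c : R))
      rw [Subring.mem_center_iff.1 c.2 s]
    simpa [Module.algebraMap_end_apply] using hc
  | grade1 i => simpa using h i y
  | mul a b ha hb =>
    rw [map_mul, map_mul, Module.End.mul_apply, ha, hb, MulOpposite.unop_mul,
      Matrix.vecMul_vecMul]
  | add a b ha hb =>
    rw [map_add, map_add, LinearMap.add_apply, map_add, ha, hb, MulOpposite.unop_add,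
      Matrix.vecMul_add]

/-- A polynomial expression in elements commuting with `s` commutes with `s`. -/
theorem FreeAlgebra.commute_lift {C A σ : Type*} [CommRing C] [Ring A] [Algebra C A]
    (s : A) (v : σ → A) (h : ∀ i, Commute s (v i)) (f : FreeAlgebra C σ) :
    Commute s (FreeAlgebra.lift C v f) := by
  induction f using FreeAlgebra.induction with
  | grade0 c =>
    rw [AlgHom.commutes]
    exact (Algebra.commutes c s).symm
  | grade1 i => simpa using h i
  | mul a b ha hb => rw [map_mul]; exact ha.mul_right hb
  | add a b ha hb => rw [map_add]; exact ha.add_right hb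

/-- A product of `k` endomorphisms that commute with `φ` and map into the image of `φ` maps into
the image of `φ ^ k`. -/
theorem List.prod_apply_mem_range_pow {R M : Type*} [Ring R] [AddCommGroup M] [Module R M]
    (φ : Module.End R M) (l : List (Module.End R M))
    (h : ∀ g ∈ l, Commute φ g ∧ ∀ y, g y ∈ LinearMap.range φ) (y : M) :
    l.prod y ∈ LinearMap.range (φ ^ l.length) := by
  induction l with
  | nil => simp
  | cons g l ih =>
    obtain ⟨hcomm, hrange⟩ := h g (by simp)
    obtain ⟨z, hz⟩ := ih fun g' hg' => h g' (by simp [hg'])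
    obtain ⟨t, ht⟩ := hrange z
    refine ⟨t, ?_⟩
    rw [List.length_cons, pow_succ, Module.End.mul_apply, ht, List.prod_cons,
      Module.End.mul_apply, ← hz, ← Module.End.mul_apply, ← Module.End.mul_apply,
      (hcomm.pow_left l.length).eq]

/-- The values on the zero-level centralizer of a polynomial identity of `rightIdealW` map into
the image of `φ`. -/
theorem NilpotentJordanBase.lift_apply_mem_range {R M Γ σ : Type*} [Ring R] [IsLocalRing R]
    [AddCommGroup M] [Module R M] {φ : Module.End R M} [Fintype Γ] [DecidableEq Γ]
    (X : NilpotentJordanBase φ Γ) (f : FreeAlgebra (Subring.center R) σ)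
    (hf : IsPolynomialIdentity X.rightIdealW f) (v : σ → Module.End R M)
    (hv : ∀ i, v i ∈ zeroCentralizer φ) (y : M) :
    FreeAlgebra.lift (Subring.center R) v f y ∈ LinearMap.range φ := by
  let x : (Σ γ, Fin (X.size γ)) → M := fun p => X.vec p.1 p.2
  obtain ⟨c, hc, hmem⟩ := exists_coordinates x (fun p => X.isSimple p.1 p.2) X.independent
    X.iSup_eq_top
  have hspan : Submodule.span R (Set.range x) = ⊤ := by
    rw [Submodule.span_range_eq_iSup]
    exact X.iSup_eq_top
  let z : Γ → Σ γ, Fin (X.size γ) := fun γ => ⟨γ, 0, X.one_le_size γ⟩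
  have hrange : ∀ γ (i : Fin (X.size γ)), (i : ℕ) ≠ 0 → X.vec γ i ∈ LinearMap.range φ := by
    intro γ i hi
    exact ⟨X.vec γ ⟨i - 1, by omega⟩, X.map_vec γ _ i (by simp; omega)⟩
  have hz : ∀ γ γ' (i : Fin (X.size γ')), (⟨γ', i⟩ : Σ γ, Fin (X.size γ)) = z γ ↔
      γ' = γ ∧ (i : ℕ) = 0 := by
    intro γ γ' i
    constructor
    · intro h
      obtain ⟨rfl, h⟩ := Sigma.mk.inj_iff.1 h
      exact ⟨rfl, congrArg Fin.val (eq_of_heq h)⟩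
    · rintro ⟨rfl, h⟩
      exact congrArg (Sigma.mk γ') (Fin.ext h)
  let π : M →ₗ[R] (Γ → R ⧸ Ring.jacobson R) := LinearMap.pi fun γ => c (z γ)
  have hπ0 : ∀ γ, π (x (z γ)) = Pi.single γ 1 := by
    intro γ
    ext δ
    simp only [π, LinearMap.pi_apply, hc, Pi.single_apply]
    exact if_congr ((hz δ γ _).trans (by simp [eq_comm])) rfl rfl
  have hπs : ∀ γ (i : Fin (X.size γ)), (i : ℕ) ≠ 0 → π (X.vec γ i) = 0 := by
    intro γ i hi
    ext δ
    simp only [π, LinearMap.pi_apply, Pi.zero_apply]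
    rw [show X.vec γ i = x ⟨γ, i⟩ from rfl, hc, if_neg]
    exact fun h => hi ((hz δ γ i).1 h).2
  have hπker : ∀ u, φ u = 0 → ∀ γ, 2 ≤ X.size γ → π u γ = 0 := by
    intro u hu γ hγ
    -- `φ` shifts each block, and only the head of `γ` lands on its second vector, so the head
    -- coordinate factors through `φ` and vanishes on `ker φ`.
    have hcomp : c (z γ) = c ⟨γ, 1, hγ⟩ ∘ₗ φ := by
      refine LinearMap.ext_on_range hspan fun ⟨δ, i⟩ => ?_
      rw [hc, LinearMap.comp_apply]
      change _ = c _ (φ (X.vec δ i))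
      by_cases hi : (i : ℕ) + 1 = X.size δ
      · rw [X.map_last δ i hi, map_zero, if_neg]
        intro h
        obtain ⟨rfl, h0⟩ := (hz γ δ i).1 h
        omega
      · have hlt : (i : ℕ) + 1 < X.size δ := by omega
        rw [X.map_vec δ i ⟨i + 1, hlt⟩ rfl, show X.vec δ ⟨i + 1, hlt⟩ = x ⟨δ, i + 1, hlt⟩ from rfl,
          hc]
        refine if_congr ((hz γ δ i).trans ?_) rfl rfl
        constructor
        · rintro ⟨rfl, h0⟩
          exact congrArg (Sigma.mk δ) (Fin.ext (by simp [h0]))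
        · intro h
          obtain ⟨rfl, h⟩ := Sigma.mk.inj_iff.1 h
          exact ⟨rfl, by simpa using congrArg Fin.val (eq_of_heq h)⟩
    simp only [π, LinearMap.pi_apply, hcomp, LinearMap.comp_apply, hu, map_zero]
  have hπrange : ∀ u, π u = 0 → u ∈ LinearMap.range φ := by
    intro u hu
    refine hmem _ u fun ⟨γ, i⟩ => ?_
    by_cases hi : (i : ℕ) = 0
    · left
      rw [(hz γ γ i).2 ⟨rfl, hi⟩]
      exact congrFun hu γ
    · exact Or.inr (hrange γ i hi)
  -- Row `δ` holds the head coordinates of the image of the head of block `δ`.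
  let w : σ → (Matrix Γ Γ (R ⧸ Ring.jacobson R))ᵐᵒᵖ :=
    fun i => MulOpposite.op (Matrix.of fun δ => π (v i (x (z δ))))
  have hw : ∀ i, w i ∈ X.rightIdealW := fun i δ γ hγ =>
    hπker _ (LinearMap.congr_fun (hv i).2 _) γ hγ
  have hvw : ∀ i u, π (v i u) = Matrix.vecMul (π u) (w i).unop := by
    intro i u
    let ρ : M →ₗ[R] (Γ → R ⧸ Ring.jacobson R) :=
      { toFun := fun u => Matrix.vecMul (π u) (w i).unop
        map_add' := fun a b => by rw [map_add, Matrix.add_vecMul]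
        map_smul' := fun a b => by rw [map_smul, Matrix.smul_vecMul]; rfl }
    -- On heads this is the choice of `w`; every other base vector lies in `im φ`, which `v i`
    -- kills, and has `π`-image zero.
    suffices π ∘ₗ v i = ρ from LinearMap.congr_fun this u
    refine LinearMap.ext_on_range hspan fun ⟨δ, j⟩ => ?_
    change π (v i (X.vec δ j)) = Matrix.vecMul (π (X.vec δ j)) (w i).unop
    by_cases hj : (j : ℕ) = 0
    · obtain rfl : j = ⟨0, X.one_le_size δ⟩ := Fin.ext hj
      change π (v i (x (z δ))) = Matrix.vecMul (π (x (z δ))) (w i).unop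
      rw [hπ0, Matrix.single_one_vecMul]
      rfl
    · obtain ⟨t, ht⟩ := hrange δ j hj
      rw [hπs δ j hj, Matrix.zero_vecMul, ← ht, ← Module.End.mul_apply, (hv i).1,
        LinearMap.zero_apply, map_zero]
  refine hπrange _ ?_
  rw [FreeAlgebra.lift_intertwines_vecMul _ π v w hvw, hf w hw, MulOpposite.unop_zero,
    Matrix.vecMul_zero]

theorem theorem3p6 {R M : Type*} [Ring R] [IsLocalRing R] [AddCommGroup M] [Module R M]
    [Module.Finite R M] [IsSemisimpleModule R M]
    (φ : Module.End R M) (hφ : IsNilpotent φ) (n : ℕ) (hn : nilpotencyClass φ = n)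
    (m : ℕ) (X : NilpotentJordanBase φ (Fin m))
    (r : ℕ) (f : Fin n → FreeAlgebra (Subring.center R) (Fin r))
    (hf : ∀ i, IsPolynomialIdentity X.rightIdealW (f i)) :
    IsPolynomialIdentity (zeroCentralizer φ) (List.ofFn f).prod := by
  intro v hv
  ext y
  have hcomm : ∀ i, Commute φ (v i) := fun i => (hv i).2.trans (hv i).1.symm
  have hmem := List.prod_apply_mem_range_pow φ
    ((List.ofFn f).map (FreeAlgebra.lift (Subring.center R) v)) (fun g hg => by
      obtain ⟨p, hp, rfl⟩ := List.mem_map.1 hg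
      obtain ⟨i, rfl⟩ := List.mem_ofFn.1 hp
      exact ⟨FreeAlgebra.commute_lift φ v hcomm (f i), X.lift_apply_mem_range (f i) (hf i) v hv⟩) y
  have hpow : φ ^ n = 0 := hn ▸ pow_nilpotencyClass hφ
  rw [List.length_map, List.length_ofFn, hpow, ← map_list_prod] at hmem
  obtain ⟨t, ht⟩ := hmem
  rw [← ht, LinearMap.zero_apply, LinearMap.zero_apply]
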